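/- Let $n$ be a positive integer, let $\Theta$ be a Borel subset of a Polish space with its Borel $\sigma$-algebra $\mathcal{B}(\Theta)$, let $\mu$ be a $\sigma$-finite measure on $\mathcal{B}(\Theta)$, and let $\mathbb{G}$ be a stochastic kernel on $\Theta$ such that for every $\ell\in\Theta$ the measure $\mathbb{G}(\ell,\cdot)$ has a density $g(\ell,\cdot)$ with respect to $\mu$. Let $A:\Theta\to\mathbb{R}^{n\times n}$ be measurable and $\mu$-essentially bounded. Consider the system, denoted by $(A|\mathbb{G})$, $$x(k+1)=A(\vartheta(k))\,x(k),\quad k\in\mathbb{N},\qquad x(0)=x_0,\quad \vartheta(0)=\vartheta_0,$$ where $\{\vartheta(k)\}_{k\in\mathbb{N}}$ is a $\Theta$-valued Markov chain with transition kernel $\mathbb{G}$. The admissible initial conditions $(x_0,\vartheta_0)$ are all deterministic vectors $x_0\in\mathbb{R}^n$ and all $\Theta$-valued random variables $\vartheta_0$ whose distribution has a density $\nu_0$ with respect to $\mu$; put $\Theta_{\vartheta_0}=\{\ell\in\Theta : \nu_0(\ell)>0\}$. The system $(A|\mathbb{G})$ is called exponentially mean-square stable if there exist $\beta\ge 1$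 and $\alpha\in(0,1)$ such that for all admissible initial conditions $(x_0,\vartheta_0)$, $$\mathbf{E}\{\|x(k)\|^2\}\le\beta\alpha^k\|x_0\|^2\quad\text{for all }k\in\mathbb{N}.$$ It is called exponentially mean-square stable with conditioning if there exist $\beta\ge 1$ and $\alpha\in(0,1)$ such that for all admissible initial conditions $(x_0,\vartheta_0)$, $$\mathbf{E}\{\|x(k)\|^2\mid\vartheta_0=\ell\}\le\beta\alpha^k\|x_0\|^2\quad\text{for all }k\in\mathbb{N}$$ holds for $\mu$-almost all $\ell\in\Theta_{\vartheta_0}$. Theorem. $(A|\mathbb{G})$ is exponentially mean-square stable if and only if it is exponentially mean-square stable with conditioning. -/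

import Mathlib

open MeasureTheory ProbabilityTheory
open scoped ENNReal NNReal

universe u

/-- `ℝⁿ` with the Euclidean norm. -/
abbrev Vec (n : ℕ) : Type := EuclideanSpace ℝ (Fin n)

/-- Real `n × n` matrices, as bounded operators of `ℝⁿ`, with the operator norm. -/
abbrev Mat (n : ℕ) : Type := Vec n →L[ℝ] Vec n

/-- The measurable, `μ`-essentially bounded matrix-valued functions on `Θ`. -/
def MemHInfty {Θ : Type*} [MeasurableSpace Θ] {n : ℕ} (μ : Measure Θ) (A : Θ → Mat n) : Prop :=
  Measurable A ∧ essSup (fun ℓ => ‖A ℓ‖ₑ) μ < ∞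

/-- The σ-algebra generated by `ϑ 0, …, ϑ k`. -/
abbrev history {Ω Θ : Type*} [MeasurableSpace Θ] (ϑ : ℕ → Ω → Θ) (k : ℕ) : MeasurableSpace Ω :=
  ⨆ j ≤ k, MeasurableSpace.comap (ϑ j) inferInstance

/-- `ϑ` is, under `P`, a time-homogeneous Markov chain with transition kernel `G`:
`P(ϑ(k+1) ∈ Λ | ϑ(0), …, ϑ(k)) = G(ϑ(k), Λ)` almost surely. The initial law is not prescribed. -/
structure IsMarkovChain {Ω Θ : Type*} [MeasurableSpace Ω] [MeasurableSpace Θ]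
    (G : Kernel Θ Θ) (P : Measure Ω) (ϑ : ℕ → Ω → Θ) : Prop where
  measurable : ∀ k, Measurable (ϑ k)
  markov : ∀ (k : ℕ) (Λ : Set Θ), MeasurableSet Λ →
    P⟦ϑ (k + 1) ⁻¹' Λ | history ϑ k⟧ =ᵐ[P] fun ω => (G (ϑ k ω)).real Λ

/-- The solution of `x(k+1) = A(ϑ(k)) x(k)`, `x(0) = x₀`, along a path of modes. -/
def state {Θ : Type*} {n : ℕ} (A : Θ → Mat n) (x₀ : Vec n) (path : ℕ → Θ) : ℕ → Vec n
  | 0 => x₀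
  | k + 1 => A (path k) (state A x₀ path k)

/-- `E{f | X = ℓ}` for a random variable `f ≥ 0`: the mean of the regular conditional
distribution of `f` given `X = ℓ`. -/
noncomputable def condExpect {Ω Θ : Type*} [MeasurableSpace Ω] [MeasurableSpace Θ]
    (P : Measure Ω) [IsFiniteMeasure P] (f : Ω → ℝ≥0∞) (X : Ω → Θ) (ℓ : Θ) : ℝ≥0∞ :=
  ∫⁻ y, y ∂(condDistrib f X P ℓ)

/-- Exponential mean-square stability of `(A | G)`. The initial conditions range over all vectors
`x₀` and all initial modes `ϑ 0` whose law is absolutely continuous with respect to `μ`. -/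
def EMSS {Θ : Type u} [MeasurableSpace Θ] {n : ℕ}
    (μ : Measure Θ) (G : Kernel Θ Θ) (A : Θ → Mat n) : Prop :=
  ∃ β α : ℝ, 1 ≤ β ∧ 0 < α ∧ α < 1 ∧
    ∀ (Ω : Type u) [MeasurableSpace Ω] (P : Measure Ω) [IsProbabilityMeasure P]
      (ϑ : ℕ → Ω → Θ) (x₀ : Vec n),
      IsMarkovChain G P ϑ → P.map (ϑ 0) ≪ μ →
        ∀ k : ℕ, ∫⁻ ω, ‖state A x₀ (fun j => ϑ j ω) k‖ₑ ^ 2 ∂P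
          ≤ ENNReal.ofReal (β * α ^ k * ‖x₀‖ ^ 2)

/-- Exponential mean-square stability with conditioning of `(A | G)`; the set of `ℓ` with
`0 < (P.map (ϑ 0)).rnDeriv μ ℓ` is the set where the initial density is positive. -/
def EMSSC {Θ : Type u} [MeasurableSpace Θ] {n : ℕ}
    (μ : Measure Θ) (G : Kernel Θ Θ) (A : Θ → Mat n) : Prop :=
  ∃ β α : ℝ, 1 ≤ β ∧ 0 < α ∧ α < 1 ∧
    ∀ (Ω : Type u) [MeasurableSpace Ω] (P : Measure Ω) [IsProbabilityMeasure P]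
      (ϑ : ℕ → Ω → Θ) (x₀ : Vec n),
      IsMarkovChain G P ϑ → P.map (ϑ 0) ≪ μ →
        ∀ᵐ ℓ ∂μ, 0 < (P.map (ϑ 0)).rnDeriv μ ℓ →
          ∀ k : ℕ, condExpect P (fun ω => ‖state A x₀ (fun j => ϑ j ω) k‖ₑ ^ 2) (ϑ 0) ℓ
            ≤ ENNReal.ofReal (β * α ^ k * ‖x₀‖ ^ 2)

/-!
Both notions of stability bound the same quantities, seen globally or one initial mode at a time.
With `f k = ‖x(k)‖²` and `ν` the law of `ϑ 0`, disintegration of the joint law of `(ϑ 0, f k)` gives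
`∫⁻ ℓ in s, E{f k | ϑ 0 = ℓ} ∂ν = ∫⁻ ω in {ϑ 0 ∈ s}, f k ∂P` for every measurable `s`
(`setLIntegral_condExpect`). Moreover, as `ν ≪ μ`, "for `μ`-almost all `ℓ` of positive density" means
"for `ν`-almost all `ℓ`" (`ae_map_iff_ae_rnDeriv_pos`).

Conditional bounds thus integrate, over the whole of `Θ`, to the unconditional one. For the converse,
the main point is that conditioning `P` on an event `{ϑ 0 ∈ s}` of the initial σ-algebra changes the
initial law only: `ϑ` remains a Markov chain with the same transition kernel (`IsMarkovChain.cond`),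
and its new initial law is still absolutely continuous with respect to `μ`. The unconditional bound
for all of these conditioned chains says that the average over any `s` of the conditional mean obeys
the bound, and hence that the conditional mean does so `ν`-almost everywhere. The constants `β` and
`α` are the same in both notions.
-/

lemma measurable_state {Θ Ω : Type*} [MeasurableSpace Θ] [MeasurableSpace Ω] {n : ℕ}
    {A : Θ → Mat n} (hA : Measurable A) {ϑ : ℕ → Ω → Θ} (hϑ : ∀ k, Measurable (ϑ k))
    (x₀ : Vec n) (k : ℕ) : Measurable fun ω => state A x₀ (fun j => ϑ j ω) k := by
  induction k with
  | zero => exact measurable_const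
  | succ k ih =>
    have happly : Measurable fun p : Mat n × Vec n => p.1 p.2 :=
      isBoundedBilinearMap_apply.continuous.measurable
    exact happly.comp ((hA.comp (hϑ k)).prodMk ih)

lemma measurable_condExpect {Ω Θ : Type*} [MeasurableSpace Ω] [MeasurableSpace Θ]
    (P : Measure Ω) [IsFiniteMeasure P] (f : Ω → ℝ≥0∞) (X : Ω → Θ) :
    Measurable (condExpect P f X) :=
  measurable_id.lintegral_kernel

lemma setLIntegral_condExpect {Ω Θ : Type*} [MeasurableSpace Ω] [MeasurableSpace Θ]
    (P : Measure Ω) [IsFiniteMeasure P] {f : Ω → ℝ≥0∞} (hf : Measurable f)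
    {X : Ω → Θ} (hX : Measurable X) {s : Set Θ} (hs : MeasurableSet s) :
    ∫⁻ ℓ in s, condExpect P f X ℓ ∂(P.map X) = ∫⁻ ω in X ⁻¹' s, f ω ∂P := by
  have h := Measure.setLIntegral_compProd (μ := P.map X) (κ := condDistrib f X P)
    measurable_snd hs MeasurableSet.univ
  rw [compProd_map_condDistrib hf.aemeasurable,
    setLIntegral_map (hs.prod MeasurableSet.univ) measurable_snd (hX.prodMk hf)] at h
  simp only [Measure.restrict_univ] at h
  have hpre : (fun ω => (X ω, f ω)) ⁻¹' (s ×ˢ Set.univ) = X ⁻¹' s := by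
    ext ω
    simp
  rw [hpre] at h
  exact h.symm

lemma lintegral_cond {Ω : Type*} [MeasurableSpace Ω] (P : Measure Ω) (s : Set Ω)
    (f : Ω → ℝ≥0∞) : ∫⁻ ω, f ω ∂P[|s] = (P s)⁻¹ * ∫⁻ ω in s, f ω ∂P := by
  rw [ProbabilityTheory.cond, lintegral_smul_measure, smul_eq_mul]

/-- When `ν ≪ μ`, the almost-everywhere statements for `ν` are those that hold `μ`-almost everywhere
on the set where `ν` has positive density. -/
lemma ae_map_iff_ae_rnDeriv_pos {Θ : Type*} [MeasurableSpace Θ] {μ ν : Measure Θ}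
    [SigmaFinite μ] [SigmaFinite ν] (hν : ν ≪ μ) {p : Θ → Prop} :
    (∀ᵐ ℓ ∂ν, p ℓ) ↔ ∀ᵐ ℓ ∂μ, 0 < ν.rnDeriv μ ℓ → p ℓ := by
  conv_lhs => rw [← Measure.withDensity_rnDeriv_eq ν μ hν]
  rw [ae_withDensity_iff (Measure.measurable_rnDeriv ν μ)]
  simp only [pos_iff_ne_zero]

lemma IsMarkovChain.history_le {Ω Θ : Type*} [mΩ : MeasurableSpace Ω] [MeasurableSpace Θ]
    {G : Kernel Θ Θ} {P : Measure Ω} {ϑ : ℕ → Ω → Θ} (h : IsMarkovChain G P ϑ) (k : ℕ) :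
    history ϑ k ≤ mΩ :=
  iSup₂_le fun j _ => (h.measurable j).comap_le

lemma measurable_history {Ω Θ : Type*} [MeasurableSpace Θ] (ϑ : ℕ → Ω → Θ) {j k : ℕ}
    (hjk : j ≤ k) : Measurable[history ϑ k] (ϑ j) :=
  (comap_measurable (ϑ j)).mono
    (le_iSup₂ (f := fun i (_ : i ≤ k) => MeasurableSpace.comap (ϑ i) inferInstance) j hjk) le_rfl

/-- A Markov chain conditioned on an event of the initial mode is a Markov chain with the same
transition kernel. -/
lemma IsMarkovChain.cond {Ω Θ : Type*} [MeasurableSpace Ω] [MeasurableSpace Θ]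
    {G : Kernel Θ Θ} [IsMarkovKernel G] {P : Measure Ω} [IsFiniteMeasure P] {ϑ : ℕ → Ω → Θ}
    (h : IsMarkovChain G P ϑ) {s : Set Θ} (hs : MeasurableSet s) :
    IsMarkovChain G P[|ϑ 0 ⁻¹' s] ϑ where
  measurable := h.measurable
  markov k Λ hΛ := by
    have hm := h.history_le k
    have hE : MeasurableSet[history ϑ k] (ϑ 0 ⁻¹' s) := measurable_history ϑ k.zero_le hs
    have hind : Measurable ((ϑ (k + 1) ⁻¹' Λ).indicator fun _ => (1 : ℝ)) :=
      measurable_const.indicator (h.measurable _ hΛ)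
    have hGΛ : Measurable fun ℓ => (G ℓ).real Λ := (G.measurable_coe hΛ).ennreal_toReal
    have hint : ∀ (Q : Measure Ω) [IsFiniteMeasure Q],
        Integrable ((ϑ (k + 1) ⁻¹' Λ).indicator fun _ => (1 : ℝ)) Q := fun Q _ =>
      (integrable_const 1).indicator (h.measurable _ hΛ)
    have hGint : ∀ (Q : Measure Ω) [IsFiniteMeasure Q],
        Integrable (fun ω => (G (ϑ k ω)).real Λ) Q := fun Q _ =>
      Integrable.of_bound (hGΛ.comp (h.measurable k)).aestronglyMeasurable 1
        (Filter.Eventually.of_forall fun ω => by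
          rw [Real.norm_of_nonneg measureReal_nonneg]
          exact measureReal_le_one)
    refine (ae_eq_condExp_of_forall_setIntegral_eq hm (hint _)
      (fun t _ _ => (hGint _).integrableOn) (fun t ht _ => ?_)
      (hGΛ.comp (measurable_history ϑ le_rfl)).stronglyMeasurable.aestronglyMeasurable).symm
    -- Under the conditioned measure, integrating over `t` is integrating over `t ∩ {ϑ 0 ∈ s}`,
    -- an event of the same history, where the Markov property of `ϑ` under `P` applies.
    have hcond : ∀ f : Ω → ℝ, ∫ ω in t, f ω ∂P[|ϑ 0 ⁻¹' s]
        = (P (ϑ 0 ⁻¹' s))⁻¹.toReal • ∫ ω in t ∩ ϑ 0 ⁻¹' s, f ω ∂P := fun f => by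
      rw [ProbabilityTheory.cond, Measure.restrict_smul, integral_smul_measure,
        Measure.restrict_restrict (hm t ht)]
    rw [hcond, hcond, ← setIntegral_condExp hm (hint P) (ht.inter hE)]
    congr 1
    exact integral_congr_ae (ae_restrict_of_ae (h.markov k Λ hΛ).symm)

/-- A bound on the mean under all conditionings of `P` on events of `X` is a bound on the
conditional mean given `X`. -/
lemma ae_condExpect_le_of_forall_lintegral_cond_le {Ω Θ : Type*} [MeasurableSpace Ω]
    [MeasurableSpace Θ] (P : Measure Ω) [IsFiniteMeasure P] {f : Ω → ℝ≥0∞} (hf : Measurable f)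
    {X : Ω → Θ} (hX : Measurable X) {c : ℝ≥0∞}
    (h : ∀ s, MeasurableSet s → P (X ⁻¹' s) ≠ 0 → ∫⁻ ω, f ω ∂P[|X ⁻¹' s] ≤ c) :
    ∀ᵐ ℓ ∂(P.map X), condExpect P f X ℓ ≤ c := by
  refine ae_le_of_forall_setLIntegral_le_of_sigmaFinite (g := fun _ => c)
    (measurable_condExpect P f X) fun s hs _ => ?_
  rw [setLIntegral_condExpect P hf hX hs, setLIntegral_const, Measure.map_apply hX hs]
  by_cases h0 : P (X ⁻¹' s) = 0
  · simp [Measure.restrict_eq_zero.2 h0]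
  · have hle := h s hs h0
    rwa [lintegral_cond, ENNReal.inv_mul_le_iff h0 (measure_ne_top _ _), mul_comm] at hle

theorem theorem1 {Θ : Type u} [MeasurableSpace Θ] [StandardBorelSpace Θ]
    (μ : Measure Θ) [SigmaFinite μ]
    (G : Kernel Θ Θ) [IsMarkovKernel G]
    (g : Θ → Θ → ℝ≥0) (hg : ∀ ℓ, Measurable (g ℓ))
    (hG : ∀ (ℓ : Θ) (Λ : Set Θ), MeasurableSet Λ → G ℓ Λ = ∫⁻ t in Λ, (g ℓ t : ℝ≥0∞) ∂μ)
    {n : ℕ} (A : Θ → Mat n) (hA : MemHInfty μ A) :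
    EMSS μ G A ↔ EMSSC μ G A := by
  constructor
  · rintro ⟨β, α, hβ, hα0, hα1, h⟩
    refine ⟨β, α, hβ, hα0, hα1, fun Ω _ P _ ϑ x₀ hϑ hμ => ?_⟩
    have := Measure.isProbabilityMeasure_map (μ := P) (hϑ.measurable 0).aemeasurable
    rw [← ae_map_iff_ae_rnDeriv_pos hμ, ae_all_iff]
    refine fun k => ae_condExpect_le_of_forall_lintegral_cond_le P
      ((measurable_state hA.1 hϑ.measurable x₀ k).enorm.pow_const 2) (hϑ.measurable 0)
      fun s hs h0 => ?_
    have := cond_isProbabilityMeasure h0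
    exact h Ω _ ϑ x₀ (hϑ.cond hs)
      ((cond_absolutelyContinuous.map (hϑ.measurable 0)).trans hμ) k
  · rintro ⟨β, α, hβ, hα0, hα1, h⟩
    refine ⟨β, α, hβ, hα0, hα1, fun Ω _ P _ ϑ x₀ hϑ hμ k => ?_⟩
    have := Measure.isProbabilityMeasure_map (μ := P) (hϑ.measurable 0).aemeasurable
    have hae := (ae_map_iff_ae_rnDeriv_pos hμ).2 (h Ω P ϑ x₀ hϑ hμ)
    have hk := setLIntegral_condExpect P
      ((measurable_state hA.1 hϑ.measurable x₀ k).enorm.pow_const 2) (hϑ.measurable 0)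
      MeasurableSet.univ
    rw [Set.preimage_univ, setLIntegral_univ, setLIntegral_univ] at hk
    rw [← hk]
    refine (lintegral_mono_ae (hae.mono fun ℓ hℓ => hℓ k)).trans ?_
    simp
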